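/- Let $p$ be an odd prime. For a group $G$ let $\gamma_1(G)=G$ and $\gamma_{i+1}(G)=[\gamma_i(G),G]$ be the terms of its lower central series. A finite $p$-group $G$ of nilpotency class $c$ is called normally constrained if for every $i=1,\dots,c$ and every normal subgroup $N$ of $G$ one has $N\le\gamma_i(G)$ or $\gamma_i(G)\le N$. Let $G$ be a normally constrained finite $p$-group whose minimal number of generators is $d(G)\ge 3$. Then $G$ has a non-inner automorphism of order $p$. -/

import Mathlib

/-- A group `G` (in practice: a finite `p`-group) is *normally constrained* if every normal
subgroup of `G` is comparable, with respect to inclusion, with every term of the lower central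
series of `G`.

In the code `(⊤ : Subgroup G).lowerCentralSeries i` is the term usually written `γ_{i+1}(G)`, so `i = 0` gives
`γ₁(G) = G`.  Terms beyond the nilpotency class are trivial and impose no condition, so letting `i`
run over all natural numbers is the same as letting it stop at the class. -/
def IsNormallyConstrained (G : Type*) [Group G] : Prop :=
  ∀ (i : ℕ) (N : Subgroup G), N.Normal →
    N ≤ (⊤ : Subgroup G).lowerCentralSeries i ∨ (⊤ : Subgroup G).lowerCentralSeries i ≤ N

/-! In the abelian case any nontrivial automorphism is non-inner, and a central twist `x ↦ x z ^ f
x` has order `p`. Otherwise let `L` be the last nontrivial term of the lower central series and `D`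
the term before it. Suppose all automorphisms of order `p` are inner, and take `z ∈ L` of order `p`.
Each homomorphism `f` to `ZMod p` kills `z`, so its central twist is conjugation by some element;
the elements so obtained form, with the center, a subgroup `S` with `|S : Z(G)| ≥ p ^ 3`.

As `p` is odd, `s ↦ s ^ p` is a homomorphism from `S` to the center, with kernel of order at least
`p ^ 3`. Comparability with `L` leaves too few central elements of order `p` to fill this kernel,
which yields a noncentral `w ∈ S` with `w ^ p = 1`. Twisting by `w` (`exists_mulAut_of_conj_eq`)
gives an automorphism of order `p`, hence conjugation by some `g`, and `⟨g, w, z⟩` is normal. If it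
lies in `D`, then `w` is central. If it contains `D`, it contains `S`; since it centralizes `ker f`,
all homomorphisms to `ZMod p` are multiples of a single one. Both are impossible. -/

/-- A crossed homomorphism with values of order dividing `p`, constant along its own displacement,
gives an automorphism of order `p`. -/
theorem exists_mulAut_of_crossedHom {G : Type*} [Group G] {p : ℕ} (hp : p.Prime) (d : G → G)
    (hmul : ∀ x y, d (x * y) = y⁻¹ * d x * y * d y) (hfix : ∀ x, d (x * d x) = d x)
    (hpow : ∀ x, d x ^ p = 1) (hne : ∃ x, d x ≠ 1) :
    ∃ φ : MulAut G, orderOf φ = p ∧ ∀ x, φ x = x * d x := by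
  let ψ : Monoid.End G := MonoidHom.mk' (fun x => x * d x) fun x y => by
    rw [hmul]; group
  have hψ : ∀ x, ψ x = x * d x := fun _ => rfl
  -- The displacement does not change along an orbit, so iterating only raises it to powers.
  have hiter : ∀ n x, (ψ ^ n) x = x * d x ^ n := by
    intro n
    induction n with
    | zero => simp
    | succ n ih =>
      intro x
      rw [pow_succ]
      change (ψ ^ n) (ψ x) = _
      rw [ih, hψ, hfix, pow_succ', mul_assoc]
  have hψp : ψ ^ p = 1 := by
    ext x
    rw [hiter, hpow, mul_one]; rfl
  have hp1 : p - 1 + 1 = p := Nat.succ_pred_eq_of_pos hp.pos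
  let φ : MulAut G := MonoidHom.toMulEquiv ψ (ψ ^ (p - 1))
    (by change ψ ^ (p - 1) * ψ = 1; rw [← pow_succ, hp1, hψp])
    (by change ψ * ψ ^ (p - 1) = 1; rw [← pow_succ', hp1, hψp])
  have hφ : ∀ x, φ x = x * d x := fun _ => rfl
  have hφn : ∀ n x, (φ ^ n) x = (ψ ^ n) x := by
    intro n
    induction n with
    | zero => intro x; rfl
    | succ n ih =>
      intro x
      rw [pow_succ, pow_succ, MulAut.mul_apply, ih]; rfl
  refine ⟨φ, ?_, hφ⟩
  have := Fact.mk hp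
  refine orderOf_eq_prime ?_ ?_
  · ext x
    rw [hφn, hψp]; rfl
  · intro h
    obtain ⟨x, hx⟩ := hne
    have := hφ x
    rw [h, MulAut.one_apply] at this
    exact hx (by simpa using this.symm)

/-! ### Homomorphisms to `ZMod p` -/

/-- A proper subgroup of a finite `p`-group is annihilated by a nonzero homomorphism to `ZMod p`. -/
theorem IsPGroup.exists_addMonoidHom_eq_zero {G : Type*} [Group G] [Finite G] {p : ℕ}
    (hp : p.Prime) (hG : IsPGroup p G) (K : Subgroup G) (hK : K ≠ ⊤) :
    ∃ f : Additive G →+ ZMod p, f ≠ 0 ∧ ∀ x ∈ K, f (Additive.ofMul x) = 0 := by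
  have := Fact.mk hp
  obtain ⟨M, hM, hKM⟩ := (eq_top_or_exists_le_coatom K).resolve_left hK
  have : Group.IsNilpotent G := hG.isNilpotent
  have hMn : M.Normal :=
    Subgroup.NormalizerCondition.normal_of_coatom M Group.normalizerCondition_of_isNilpotent hM
  have : Nontrivial (G ⧸ M) := QuotientGroup.nontrivial_iff.mpr hM.1
  have : IsSimpleGroup (G ⧸ M) := ⟨fun H _ => by
    have hle : M ≤ H.comap (QuotientGroup.mk' M) := by
      intro x hx
      rw [Subgroup.mem_comap, QuotientGroup.mk'_apply, (QuotientGroup.eq_one_iff x).mpr hx]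
      exact H.one_mem
    have hsurj := QuotientGroup.mk'_surjective M
    rcases hM.le_iff.mp hle with h | h
    · right
      rw [← Subgroup.map_comap_eq_self_of_surjective hsurj H, h,
        Subgroup.map_top_of_surjective _ hsurj]
    · left
      rw [← Subgroup.map_comap_eq_self_of_surjective hsurj H, h, QuotientGroup.map_mk'_self]⟩
  have : Group.IsNilpotent (G ⧸ M) := (hG.to_quotient M).isNilpotent
  let : CommGroup (G ⧸ M) := inferInstance
  have hpr : (Nat.card (G ⧸ M)).Prime := CommGroup.is_simple_iff_prime_card.mp inferInstance
  have hcard : Nat.card (G ⧸ M) = p := by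
    rcases (hG.to_quotient M).card_eq_or_dvd with h | h
    · exact absurd h hpr.ne_one
    · exact ((Nat.prime_dvd_prime_iff_eq hp hpr).mp h).symm
  have : IsCyclic (G ⧸ M) := isCyclic_of_prime_card hcard
  have e : (G ⧸ M) ≃* Multiplicative (ZMod p) :=
    mulEquivOfCyclicCardEq (by rw [hcard]; simp)
  refine ⟨MonoidHom.toAdditiveLeft (e.toMonoidHom.comp (QuotientGroup.mk' M)), ?_, ?_⟩
  · intro h
    refine hM.1 (eq_top_iff.mpr fun x _ => ?_)
    rw [← QuotientGroup.eq_one_iff, ← e.map_eq_one_iff]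
    exact DFunLike.congr_fun h (Additive.ofMul x)
  · intro x hx
    change e (QuotientGroup.mk x) = 1
    rw [(QuotientGroup.eq_one_iff x).mpr (hKM hx), map_one]

theorem AddMonoidHom.card_eq_mul_card_ker_of_zmod {A : Type*} [AddGroup A] [Finite A] {p : ℕ}
    (hp : p.Prime) (φ : A →+ ZMod p) (hφ : φ ≠ 0) : Nat.card A = p * Nat.card φ.ker := by
  have := Fact.mk hp
  rw [← AddSubgroup.index_mul_card φ.ker, AddSubgroup.index_ker]
  congr 1
  have hd := AddSubgroup.card_addSubgroup_dvd_card φ.range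
  rw [Nat.card_zmod] at hd
  refine ((Nat.dvd_prime hp).mp hd).resolve_left fun h => hφ ?_
  rw [AddSubgroup.card_eq_one] at h
  exact AddMonoidHom.range_eq_bot_iff.mp h

/-- A finite `p`-group needing at least three generators has at least `p ^ 3` homomorphisms to
`ZMod p`. -/
theorem IsPGroup.pow_three_le_card_addMonoidHom {G : Type*} [Group G] [Finite G] {p : ℕ}
    (hp : p.Prime) (hG : IsPGroup p G) (hrank : 3 ≤ Group.rank G) :
    p ^ 3 ≤ Nat.card (Additive G →+ ZMod p) := by
  classical
  have := Fact.mk hp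
  have : Finite (Additive G →+ ZMod p) := DFunLike.finite _
  have generates : ∀ S : Finset G, S.card ≤ 2 →
      ∃ f : Additive G →+ ZMod p, (∀ x ∈ S, f (Additive.ofMul x) = 0) ∧ f ≠ 0 := by
    intro S hS
    by_cases hcl : Subgroup.closure (S : Set G) = ⊤
    · exact absurd (hrank.trans ((Group.rank_le hcl).trans hS)) (by norm_num)
    · obtain ⟨f, hf, h⟩ := hG.exists_addMonoidHom_eq_zero hp _ hcl
      exact ⟨f, fun x hx => h x (Subgroup.subset_closure hx), hf⟩
  -- Evaluation at a point where some member of `W` is nonzero cuts `W` down by exactly a factor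
  -- `p`. As two elements never generate `G`, this can be done three times.
  have step : ∀ W : AddSubgroup (Additive G →+ ZMod p), (∃ f ∈ W, f ≠ 0) →
      ∃ (x : G) (W' : AddSubgroup (Additive G →+ ZMod p)), Nat.card W = p * Nat.card W' ∧
        ∀ f, f ∈ W → f (Additive.ofMul x) = 0 → f ∈ W' := by
    rintro W ⟨f, hfW, hf⟩
    obtain ⟨x, hx⟩ := DFunLike.ne_iff.mp hf
    let φ : W →+ ZMod p := (AddMonoidHom.eval x).comp W.subtype
    refine ⟨Additive.toMul x, φ.ker.map W.subtype, ?_, fun g hg hgx => ⟨⟨g, hg⟩, hgx, rfl⟩⟩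
    rw [φ.card_eq_mul_card_ker_of_zmod hp fun h => hx (DFunLike.congr_fun h ⟨f, hfW⟩)]
    congr 1
    exact Nat.card_congr (φ.ker.equivMapOfInjective W.subtype W.subtype_injective).toEquiv
  obtain ⟨f₀, -, hf₀⟩ := generates ∅ (by simp)
  obtain ⟨x₁, W₁, hc₁, hW₁⟩ := step ⊤ ⟨f₀, trivial, hf₀⟩
  obtain ⟨f₁, hv₁, hf₁⟩ := generates {x₁} (by simp)
  obtain ⟨x₂, W₂, hc₂, hW₂⟩ := step W₁ ⟨f₁, hW₁ _ trivial (hv₁ _ (by simp)), hf₁⟩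
  obtain ⟨f₂, hv₂, hf₂⟩ := generates {x₁, x₂} Finset.card_le_two
  obtain ⟨x₃, W₃, hc₃, -⟩ := step W₂
    ⟨f₂, hW₂ _ (hW₁ _ trivial (hv₂ _ (by simp))) (hv₂ _ (by simp)), hf₂⟩
  rw [AddSubgroup.card_top] at hc₁
  rw [hc₁, hc₂, hc₃]
  have : 0 < Nat.card W₃ := Nat.card_pos
  calc p ^ 3 = p * (p * (p * 1)) := by ring
    _ ≤ _ := by gcongr; exact this

/-! ### Exponents in `ZMod p` and automorphisms of order `p` -/

theorem pow_val_add_of_pow_eq_one {M : Type*} [Monoid M] {p : ℕ} [NeZero p] {z : M}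
    (hz : z ^ p = 1) (a b : ZMod p) : z ^ (a + b).val = z ^ a.val * z ^ b.val := by
  rw [ZMod.val_add, ← pow_eq_pow_mod _ hz, pow_add]

theorem pow_val_mul_of_pow_eq_one {M : Type*} [Monoid M] {p : ℕ} [NeZero p] {z : M}
    (hz : z ^ p = 1) (a b : ZMod p) : z ^ (a * b).val = (z ^ a.val) ^ b.val := by
  rw [ZMod.val_mul, ← pow_eq_pow_mod _ hz, pow_mul]

theorem eq_zero_of_pow_val_eq_one {G : Type*} [Group G] {p : ℕ} (hp : p.Prime) {z : G}
    (hz : z ^ p = 1) (hz1 : z ≠ 1) {a : ZMod p} (h : z ^ a.val = 1) : a = 0 := by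
  have := Fact.mk hp
  have hd := orderOf_dvd_of_pow_eq_one h
  rw [orderOf_eq_prime hz hz1] at hd
  exact (ZMod.val_eq_zero a).mp (Nat.eq_zero_of_dvd_of_lt hd (ZMod.val_lt a))

theorem AddMonoidHom.map_ofMul_mul {G A : Type*} [Group G] [AddGroup A] (f : Additive G →+ A)
    (x y : G) : f (.ofMul (x * y)) = f (.ofMul x) + f (.ofMul y) :=
  f.map_add _ _

theorem AddMonoidHom.exists_eq_one_of_ne_zero {A : Type*} [AddGroup A] {p : ℕ} (hp : p.Prime)
    {f : A →+ ZMod p} (hf : f ≠ 0) : ∃ t, f t = 1 := by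
  have := Fact.mk hp
  obtain ⟨x, hx⟩ := DFunLike.ne_iff.mp hf
  refine ⟨(f x)⁻¹.val • x, ?_⟩
  rw [map_nsmul, nsmul_eq_mul, ZMod.natCast_zmod_val, inv_mul_cancel₀ hx]

/-- The automorphism `x ↦ x z ^ f x` attached to a central element `z` of order `p`. -/
theorem exists_mulAut_of_mem_center {G : Type*} [Group G] {p : ℕ} (hp : p.Prime) {z : G}
    (hzc : z ∈ Subgroup.center G) (hz : z ^ p = 1) (hz1 : z ≠ 1) {f : Additive G →+ ZMod p}
    (hf : f ≠ 0) (hfz : f (.ofMul z) = 0) :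
    ∃ φ : MulAut G, orderOf φ = p ∧ ∀ x, φ x = x * z ^ (f (.ofMul x)).val := by
  have := Fact.mk hp
  refine exists_mulAut_of_crossedHom hp (fun x => z ^ (f (.ofMul x)).val) ?_ ?_ ?_ ?_
  · intro x y
    have : y⁻¹ * z ^ (f (.ofMul x)).val * y = z ^ (f (.ofMul x)).val := by
      rw [mul_assoc, ← Subgroup.mem_center_iff.mp (pow_mem hzc _) y, inv_mul_cancel_left]
    rw [this, f.map_ofMul_mul, pow_val_add_of_pow_eq_one hz]
  · intro x
    simp only [f.map_ofMul_mul, ofMul_pow, map_nsmul, hfz, smul_zero, add_zero]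
  · intro x
    rw [← pow_mul, mul_comm, pow_mul, hz, one_pow]
  · obtain ⟨x, hx⟩ := DFunLike.ne_iff.mp hf
    exact ⟨x.toMul, fun h => hx (eq_zero_of_pow_val_eq_one hp hz hz1 h)⟩

/-- The automorphism `x ↦ x w ^ f x z ^ (f x ^ 2 / 2)` attached to an element `w` of order `p` whose
commutators are powers of a central element `z` of order `p`. -/
theorem exists_mulAut_of_conj_eq {G : Type*} [Group G] {p : ℕ} (hp : p.Prime) (hodd : Odd p)
    {w z : G} (hzc : z ∈ Subgroup.center G) (hz : z ^ p = 1) (hz1 : z ≠ 1) (hw : w ^ p = 1)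
    {f : Additive G →+ ZMod p} (hwf : ∀ x, w * x * w⁻¹ = x * z ^ (f (.ofMul x)).val)
    (hwc : w ∉ Subgroup.center G) :
    ∃ φ : MulAut G, orderOf φ = p ∧
      ∀ x, φ x = x * (w ^ (f (.ofMul x)).val * z ^ (f (.ofMul x) ^ 2 * 2⁻¹).val) := by
  have := Fact.mk hp
  have h2 : (2 : ZMod p) ≠ 0 := by
    intro h
    have h' : ((2 : ℕ) : ZMod p) = 0 := by exact_mod_cast h
    rw [ZMod.natCast_eq_zero_iff] at h'
    have := Nat.le_of_dvd two_pos h'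
    have := hp.two_le
    obtain ⟨k, hk⟩ := hodd
    omega
  have hzcomm : ∀ x, Commute x z := fun x => Subgroup.mem_center_iff.mp hzc x
  have hfix : ∀ x, w * x * w⁻¹ = x → f (.ofMul x) = 0 := fun x hx => by
    have := hwf x
    rw [hx, left_eq_mul] at this
    exact eq_zero_of_pow_val_eq_one hp hz hz1 this
  have hfw : f (.ofMul w) = 0 := hfix w (by group)
  have hfz : f (.ofMul z) = 0 := hfix z (by rw [(hzcomm w).eq, mul_inv_cancel_right])
  refine exists_mulAut_of_crossedHom hp
    (fun x => w ^ (f (.ofMul x)).val * z ^ (f (.ofMul x) ^ 2 * 2⁻¹).val) ?_ ?_ ?_ ?_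
  · intro x y
    simp only [f.map_ofMul_mul]
    generalize f (.ofMul x) = a
    have hy : y⁻¹ * w * y = z ^ (f (.ofMul y)).val * w := by
      rw [mul_assoc, inv_mul_eq_iff_eq_mul, ← mul_assoc, ← hwf, inv_mul_cancel_right]
    have hyn : ∀ n : ℕ, y⁻¹ * w ^ n * y = (z ^ (f (.ofMul y)).val) ^ n * w ^ n := by
      intro n
      rw [← ((hzcomm w).pow_right _).symm.mul_pow, ← hy]
      have := conj_pow (i := n) (a := y⁻¹) (b := w)
      simpa using this.symm
    generalize f (.ofMul y) = b at *
    -- Conjugating `w ^ a` by `y` costs `z ^ (a * b)`; this is the cross term of the quadratic form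
    -- `a ^ 2 / 2`.
    have hsq : (a + b) ^ 2 * 2⁻¹ = a ^ 2 * 2⁻¹ + b ^ 2 * 2⁻¹ + b * a := by
      field_simp
      ring
    have hzy := ((hzcomm y).pow_right (a ^ 2 * 2⁻¹).val).eq
    have hzw := ((hzcomm (w ^ b.val)).pow_right (a ^ 2 * 2⁻¹).val).eq
    have hzw' := ((hzcomm (w ^ a.val * w ^ b.val)).pow_right (b * a).val).eq
    rw [hsq, pow_val_add_of_pow_eq_one hw, pow_val_add_of_pow_eq_one hz,
      pow_val_add_of_pow_eq_one hz]
    calc w ^ a.val * w ^ b.val * (z ^ (a ^ 2 * 2⁻¹).val * z ^ (b ^ 2 * 2⁻¹).val * z ^ (b * a).val)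
        = (w ^ a.val * w ^ b.val * z ^ (b * a).val) *
            (z ^ (a ^ 2 * 2⁻¹).val * z ^ (b ^ 2 * 2⁻¹).val) := by
          rw [((Commute.refl z).pow_pow _ _ |>.mul_left ((Commute.refl z).pow_pow _ _)).eq]
          simp only [mul_assoc]
      _ = (z ^ (b * a).val * w ^ a.val) * (w ^ b.val * z ^ (a ^ 2 * 2⁻¹).val) *
            z ^ (b ^ 2 * 2⁻¹).val := by
          rw [hzw']; simp only [mul_assoc]
      _ = (y⁻¹ * w ^ a.val * y) * (z ^ (a ^ 2 * 2⁻¹).val * w ^ b.val) * z ^ (b ^ 2 * 2⁻¹).val := by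
          rw [hyn, pow_val_mul_of_pow_eq_one hz, hzw]
      _ = y⁻¹ * w ^ a.val * (y * z ^ (a ^ 2 * 2⁻¹).val) * w ^ b.val * z ^ (b ^ 2 * 2⁻¹).val := by
          simp only [mul_assoc]
      _ = _ := by
          rw [hzy]; simp only [mul_assoc]
  · intro x
    simp only [f.map_ofMul_mul, ofMul_pow, map_nsmul, hfz, hfw, smul_zero, add_zero]
  · intro x
    rw [((hzcomm w).pow_pow _ _).mul_pow, ← pow_mul, ← pow_mul, mul_comm _ p, mul_comm _ p,
      pow_mul, pow_mul, hw, hz, one_pow, one_pow, one_mul]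
  · have hf : f ≠ 0 := by
      rintro rfl
      refine hwc (Subgroup.mem_center_iff.mpr fun x => ?_)
      have := hwf x
      simp only [AddMonoidHom.zero_apply, ZMod.val_zero, pow_zero, mul_one] at this
      rw [mul_inv_eq_iff_eq_mul] at this
      exact this.symm
    obtain ⟨t, ht⟩ := AddMonoidHom.exists_eq_one_of_ne_zero hp hf
    refine ⟨t.toMul, fun h => hwc ?_⟩
    simp only [ofMul_toMul, ht, ZMod.val_one, pow_one] at h
    rw [mul_eq_one_iff_eq_inv] at h
    rw [h]
    exact inv_mem (pow_mem hzc _)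

/-! ### Powers and elements of order `p` -/

/-- In odd prime exponent of the commutator, taking `p`-th powers is multiplicative. -/
theorem mul_pow_of_swap_eq_mul_center {G : Type*} [Group G] {p : ℕ} (hp : p.Prime) (hodd : Odd p)
    {a b u : G} (huc : u ∈ Subgroup.center G) (hu : u ^ p = 1) (hab : b * a = a * b * u) :
    (a * b) ^ p = a ^ p * b ^ p := by
  have hc : ∀ x, Commute x u := fun x => Subgroup.mem_center_iff.mp huc x
  have hba : ∀ n, b ^ n * a = a * b ^ n * u ^ n := by
    intro n
    induction n with
    | zero => simp
    | succ n ih =>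
      calc b ^ (n + 1) * a = b ^ n * (b * a) := by rw [pow_succ, mul_assoc]
        _ = (b ^ n * a) * b * u := by rw [hab]; simp only [mul_assoc]
        _ = a * b ^ n * (u ^ n * b) * u := by rw [ih]; simp only [mul_assoc]
        _ = _ := by
          rw [← ((hc b).pow_right n).eq, pow_succ, pow_succ]; simp only [mul_assoc]
  have key : ∀ n, (a * b) ^ n = a ^ n * b ^ n * u ^ n.choose 2 := by
    intro n
    induction n with
    | zero => simp
    | succ n ih =>
      calc (a * b) ^ (n + 1) = a ^ n * b ^ n * (u ^ n.choose 2 * (a * b)) := by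
            rw [pow_succ, ih, mul_assoc]
        _ = a ^ n * (b ^ n * a) * b * u ^ n.choose 2 := by
            rw [← ((hc (a * b)).pow_right _).eq]; simp only [mul_assoc]
        _ = a ^ n * a * b ^ n * (u ^ n * b) * u ^ n.choose 2 := by
            rw [hba]; simp only [mul_assoc]
        _ = _ := by
            rw [← ((hc b).pow_right n).eq, pow_succ, pow_succ, Nat.choose_succ_succ' n 1,
              Nat.choose_one_right, pow_add]
            simp only [mul_assoc]
  have h2 : 2 < p := by
    have := hp.two_le
    obtain ⟨k, hk⟩ := hodd
    omega
  obtain ⟨k, hk⟩ := hp.dvd_choose_self two_ne_zero h2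
  rw [key, hk, pow_mul, hu, one_pow, mul_one]

theorem Subgroup.normal_zpowers_sup {G : Type*} [Group G] {s : G} {K : Subgroup G} [K.Normal]
    (h : ∀ x, x * s * x⁻¹ ∈ zpowers s ⊔ K) : (zpowers s ⊔ K).Normal := by
  refine ⟨fun n hn x => ?_⟩
  obtain ⟨_, ⟨i, rfl⟩, k, hk, rfl⟩ := Subgroup.mem_sup_of_normal_right.mp hn
  simp only
  rw [← conj_mul, ← conj_zpow]
  exact mul_mem (zpow_mem (h x) i) (mem_sup_right (‹K.Normal›.conj_mem k hk x))

/-- An abelian `p`-group generated by two elements, one of them of order `p`, has at most `p ^ 2`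
elements of order dividing `p`. -/
theorem IsPGroup.ncard_pow_eq_one_le_sq {G : Type*} [Group G] [Finite G] {p : ℕ} (hp : p.Prime)
    (hG : IsPGroup p G) {s z : G} (hs : s ≠ 1) (hsz : Commute s z) (hz : z ^ p = 1) :
    {x : G | x ^ p = 1 ∧ ∃ i j : ℤ, s ^ i * z ^ j = x}.ncard ≤ p ^ 2 := by
  have := Fact.mk hp
  obtain ⟨e, he⟩ := IsPGroup.iff_orderOf.mp hG s
  obtain _ | e := e
  · exact absurd (orderOf_eq_one_iff.mp (by simpa using he)) hs
  have hu : (s ^ p ^ e) ^ p = 1 := by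
    rw [← pow_mul, ← pow_succ, ← he, pow_orderOf_eq_one]
  have hle : ∀ y : G, y ^ p = 1 → Nat.card (Subgroup.zpowers y) ≤ p := fun y hy => by
    rw [Nat.card_zpowers]
    exact orderOf_le_of_pow_eq_one hp.pos hy
  let F : Subgroup.zpowers (s ^ p ^ e) × Subgroup.zpowers z → G := fun q => q.1 * q.2
  have hsub : {x : G | x ^ p = 1 ∧ ∃ i j : ℤ, s ^ i * z ^ j = x} ⊆ Set.range F := by
    rintro _ ⟨h1, i, j, rfl⟩
    rw [((hsz.zpow_left i).zpow_right j).mul_pow, ← zpow_natCast (z ^ j), zpow_comm, zpow_natCast,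
      hz, one_zpow, mul_one, ← zpow_natCast, ← zpow_mul, ← orderOf_dvd_iff_zpow_eq_one, he,
      pow_succ] at h1
    -- From `s ^ (i * p) = 1` it follows that `p ^ e ∣ i`, so the `s`-part lies in the subgroup of
    -- order at most `p` generated by `s ^ p ^ e`.
    push_cast at h1
    obtain ⟨k, rfl⟩ := Int.dvd_of_mul_dvd_mul_right (by exact_mod_cast hp.ne_zero) h1
    refine ⟨⟨⟨(s ^ p ^ e) ^ k, k, rfl⟩, ⟨z ^ j, j, rfl⟩⟩, ?_⟩
    change (s ^ p ^ e) ^ k * z ^ j = _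
    rw [← zpow_natCast, ← zpow_mul]
    push_cast
    rfl
  calc _ ≤ (Set.range F).ncard := Set.ncard_le_ncard hsub
    _ = Nat.card (Set.range F) := (Nat.card_coe_set_eq _).symm
    _ ≤ Nat.card (Subgroup.zpowers (s ^ p ^ e) × Subgroup.zpowers z) :=
      Finite.card_range_le F
    _ ≤ p * p := by
      rw [Nat.card_prod]
      exact Nat.mul_le_mul (hle _ hu) (hle _ hz)
    _ = p ^ 2 := (sq p).symm

/-! ### Elements inducing central twists -/

/-- The subgroup of elements acting on `G` by `x ↦ x z ^ f x` for some homomorphism `f` to `ZMod p`,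
where `z` is central of order dividing `p`. -/
def conjHomSubgroup {G : Type*} [Group G] {p : ℕ} [NeZero p] {z : G}
    (hzc : z ∈ Subgroup.center G) (hz : z ^ p = 1) : Subgroup G where
  carrier := {s | ∃ f : Additive G →+ ZMod p, ∀ x, s * x * s⁻¹ = x * z ^ (f (.ofMul x)).val}
  one_mem' := ⟨0, fun x => by simp⟩
  mul_mem' := by
    rintro a b ⟨f, hf⟩ ⟨f', hf'⟩
    refine ⟨f + f', fun x => ?_⟩
    have hc := Subgroup.mem_center_iff.mp (pow_mem hzc (f' (.ofMul x)).val) a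
    calc a * b * x * (a * b)⁻¹ = a * (b * x * b⁻¹) * a⁻¹ := by group
      _ = a * x * (z ^ (f' (.ofMul x)).val * a⁻¹) := by rw [hf']; simp only [mul_assoc]
      _ = a * x * a⁻¹ * z ^ (f' (.ofMul x)).val := by
        rw [← Subgroup.mem_center_iff.mp (pow_mem hzc (f' (.ofMul x)).val) a⁻¹]
        simp only [mul_assoc]
      _ = _ := by
        rw [hf, AddMonoidHom.add_apply, pow_val_add_of_pow_eq_one hz, mul_assoc]
  inv_mem' := by
    rintro s ⟨f, hf⟩
    refine ⟨-f, fun x => ?_⟩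
    have h1 : z ^ (f (.ofMul x)).val * z ^ ((-f) (.ofMul x)).val = 1 := by
      rw [← pow_val_add_of_pow_eq_one hz]; simp
    have h2 : s * (x * z ^ ((-f) (.ofMul x)).val) * s⁻¹ = x := by
      calc _ = s * x * (z ^ ((-f) (.ofMul x)).val * s⁻¹) := by simp only [mul_assoc]
        _ = s * x * s⁻¹ * z ^ ((-f) (.ofMul x)).val := by
          rw [← Subgroup.mem_center_iff.mp (pow_mem hzc ((-f) (.ofMul x)).val) s⁻¹]
          simp only [mul_assoc]
        _ = x := by rw [hf, mul_assoc, h1, mul_one]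
    calc s⁻¹ * x * s⁻¹⁻¹ = s⁻¹ * (s * (x * z ^ ((-f) (.ofMul x)).val) * s⁻¹) * s := by
          rw [h2, inv_inv]
      _ = _ := by group

section

variable {G : Type*} [Group G] {p : ℕ} [NeZero p] {z : G}
  {hzc : z ∈ Subgroup.center G} {hz : z ^ p = 1}

theorem exists_conj_eq_mul_zpow_of_mem_conjHomSubgroup {s : G}
    (hs : s ∈ conjHomSubgroup hzc hz) (x : G) : ∃ i : ℤ, x * s * x⁻¹ = s * z ^ i := by
  obtain ⟨f, hf⟩ := hs
  refine ⟨-(f (.ofMul x)).val, ?_⟩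
  have h := hf x
  rw [zpow_neg, zpow_natCast, eq_mul_inv_iff_mul_eq, mul_assoc,
    Subgroup.mem_center_iff.mp (pow_mem hzc _) x⁻¹, ← mul_assoc, mul_assoc x,
    Subgroup.mem_center_iff.mp (pow_mem hzc _) s, ← mul_assoc x, ← h]
  group

/-- Conjugation multiplies `s` by a power of `z`, which is central and killed by `p`. -/
theorem pow_mem_center_of_mem_conjHomSubgroup {s : G} (hs : s ∈ conjHomSubgroup hzc hz) :
    s ^ p ∈ Subgroup.center G := by
  refine Subgroup.mem_center_iff.mpr fun x => ?_
  obtain ⟨i, hi⟩ := exists_conj_eq_mul_zpow_of_mem_conjHomSubgroup hs x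
  have hc : Commute s (z ^ i) := Subgroup.mem_center_iff.mp (zpow_mem hzc i) s
  rw [← mul_inv_eq_iff_eq_mul, ← conj_pow, hi, hc.mul_pow, ← zpow_natCast (z ^ i), zpow_comm,
    zpow_natCast, hz, one_zpow, mul_one]

theorem normal_zpowers_of_mem_center {z : G} (hzc : z ∈ Subgroup.center G) :
    (Subgroup.zpowers z).Normal :=
  ⟨fun n hn x => by
    obtain ⟨i, rfl⟩ := hn
    simp only
    rw [Subgroup.mem_center_iff.mp (zpow_mem hzc i) x, mul_inv_cancel_right]
    exact ⟨i, rfl⟩⟩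

theorem normal_zpowers_sup_of_mem_conjHomSubgroup {s : G} (hs : s ∈ conjHomSubgroup hzc hz) :
    (Subgroup.zpowers s ⊔ Subgroup.zpowers z).Normal := by
  have := normal_zpowers_of_mem_center hzc
  refine Subgroup.normal_zpowers_sup fun x => ?_
  obtain ⟨i, hi⟩ := exists_conj_eq_mul_zpow_of_mem_conjHomSubgroup hs x
  rw [hi]
  exact mul_mem (Subgroup.mem_sup_left (Subgroup.mem_zpowers s))
    (Subgroup.mem_sup_right ⟨i, rfl⟩)

theorem mem_zpowers_sup_zpowers_iff (hzc : z ∈ Subgroup.center G) {s x : G} :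
    x ∈ Subgroup.zpowers s ⊔ Subgroup.zpowers z ↔ ∃ i j : ℤ, s ^ i * z ^ j = x := by
  have := normal_zpowers_of_mem_center hzc
  rw [Subgroup.mem_sup_of_normal_right]
  simp [Subgroup.mem_zpowers_iff]

end

/-! ### The main contradiction -/

/-- Let `G` be a finite `p`-group, `p` odd, with at least `p ^ 3` homomorphisms to `ZMod p`, and let
`L`, `D` be comparable with all normal subgroups, with `L` a nontrivial central subgroup of the
commutator subgroup and `D` noncentral but central modulo the center. Then `G` has a non-inner
automorphism of order `p`. -/
theorem exists_mulAut_not_mem_range_conj_of_comparable {p : ℕ} (hp : p.Prime) (hodd : Odd p)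
    {G : Type*} [Group G] [Finite G] (hG : IsPGroup p G)
    (hV : p ^ 3 ≤ Nat.card (Additive G →+ ZMod p)) {L D : Subgroup G}
    (hL : L ≠ ⊥) (hLc : L ≤ Subgroup.center G) (hLcomm : L ≤ commutator G)
    (hDL : ∀ g ∈ D, ∀ x, x⁻¹ * g * x * g⁻¹ ∈ Subgroup.center G)
    (hDc : ¬ D ≤ Subgroup.center G)
    (hcmpL : ∀ N : Subgroup G, N.Normal → N ≤ L ∨ L ≤ N)
    (hcmpD : ∀ N : Subgroup G, N.Normal → N ≤ D ∨ D ≤ N) :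
    ∃ φ : MulAut G, orderOf φ = p ∧ φ ∉ (MulAut.conj : G →* MulAut G).range := by
  have := Fact.mk hp
  have hfin : Finite (Additive G →+ ZMod p) := DFunLike.finite _
  by_contra! H
  have hinner : ∀ d : G → G, (∃ φ : MulAut G, orderOf φ = p ∧ ∀ x, φ x = x * d x) →
      ∃ g, ∀ x, g * x * g⁻¹ = x * d x := by
    rintro d ⟨φ, hφ, hd⟩
    obtain ⟨g, rfl⟩ := H φ hφ
    exact ⟨g, hd⟩
  -- If `L ≤ ⟨y⟩` with `y` of order `p`, then `L = ⟨y⟩` because `L` is nontrivial.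
  have hΩ : ∀ y ∈ Subgroup.center G, y ^ p = 1 → y ∈ L := by
    intro y hyc hy
    by_cases hy1 : y = 1
    · rw [hy1]; exact L.one_mem
    rcases hcmpL _ (normal_zpowers_of_mem_center hyc) with h | h
    · exact h (Subgroup.mem_zpowers y)
    · have hd := Subgroup.card_dvd_of_le h
      have hcard : Nat.card (Subgroup.zpowers y) = p := by
        rw [Nat.card_zpowers, orderOf_eq_prime hy hy1]
      rw [hcard] at hd
      rcases (Nat.dvd_prime hp).mp hd with h1 | h1
      · exact absurd (Subgroup.card_eq_one.mp h1) hL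
      · rw [Subgroup.eq_of_le_of_card_ge h (by rw [h1, hcard])]
        exact Subgroup.mem_zpowers y
  obtain ⟨z, hzL, hz, hz1⟩ : ∃ z ∈ L, z ^ p = 1 ∧ z ≠ 1 := by
    have hd : p ∣ Nat.card L := (hG.to_subgroup L).card_eq_or_dvd.resolve_left
      fun h => hL (Subgroup.card_eq_one.mp h)
    obtain ⟨y, hy⟩ := exists_prime_orderOf_dvd_card' p hd
    refine ⟨y, y.2, ?_, ?_⟩
    · have := pow_orderOf_eq_one y
      rw [hy] at this
      exact_mod_cast congrArg Subtype.val this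
    · intro h
      rw [show y = 1 from Subtype.ext h, orderOf_one] at hy
      exact hp.one_lt.ne hy
  have hzc := hLc hzL
  have hfz : ∀ f : Additive G →+ ZMod p, f (.ofMul z) = 0 := fun f =>
    Abelianization.commutator_subset_ker (MonoidHom.toAdditiveLeft.symm f) (hLcomm hzL)
  have hgf : ∀ f : Additive G →+ ZMod p, ∃ g, ∀ x, g * x * g⁻¹ = x * z ^ (f (.ofMul x)).val := by
    intro f
    by_cases hf : f = 0
    · exact ⟨1, fun x => by simp [hf]⟩
    · exact hinner _ (exists_mulAut_of_mem_center hp hzc hz hz1 hf (hfz f))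
  choose γ hγ using hgf
  let S := conjHomSubgroup hzc hz
  have hγS : ∀ f, γ f ∈ S := fun f => ⟨f, hγ f⟩
  have hγinj : ∀ f f' y y', y ∈ Subgroup.center G → y' ∈ Subgroup.center G →
      γ f * y = γ f' * y' → f = f' := by
    intro f f' y y' hy hy' h
    refine AddMonoidHom.ext fun x : G => ?_
    have key : ∀ f y, y ∈ Subgroup.center G → γ f * y * x * (γ f * y)⁻¹ =
        x * z ^ (f (.ofMul x)).val := by
      intro f y hy
      rw [← hγ f x, mul_inv_rev, mul_assoc (γ f), ← Subgroup.mem_center_iff.mp hy]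
      simp only [mul_assoc, mul_inv_cancel_left]
    have h1 := key f y hy
    rw [h, key f' y' hy'] at h1
    have h2 := mul_left_cancel h1
    have h3 : z ^ (f' (.ofMul x) - f (.ofMul x)).val = 1 := by
      have := pow_val_add_of_pow_eq_one hz (f' (.ofMul x) - f (.ofMul x)) (f (.ofMul x))
      rw [sub_add_cancel, h2] at this
      exact right_eq_mul.mp this
    exact (sub_eq_zero.mp (eq_zero_of_pow_val_eq_one hp hz hz1 h3)).symm
  have hnc : ∀ f : Additive G →+ ZMod p, f ≠ 0 → γ f ∉ Subgroup.center G := by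
    intro f hf hc
    have h0 : γ 0 ∈ Subgroup.center G := Subgroup.mem_center_iff.mpr fun x => by
      have := hγ 0 x
      simp only [AddMonoidHom.zero_apply, ZMod.val_zero, pow_zero, mul_one] at this
      exact (mul_inv_eq_iff_eq_mul.mp this).symm
    exact hf (hγinj f 0 (γ 0) (γ f) h0 hc (Subgroup.mem_center_iff.mp h0 _))
  obtain ⟨w, hwS, hw, hwc⟩ : ∃ w ∈ S, w ^ p = 1 ∧ w ∉ Subgroup.center G := by
    by_contra! hcon
    let π : S →* Subgroup.center G :=
      MonoidHom.mk' (fun s => ⟨(s : G) ^ p, pow_mem_center_of_mem_conjHomSubgroup s.2⟩) <| by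
        rintro ⟨a, ha⟩ ⟨b, f, hf⟩
        refine Subtype.ext (mul_pow_of_swap_eq_mul_center hp hodd
          (u := z ^ (f (.ofMul a)).val) (pow_mem hzc _) ?_ ?_)
        · rw [← pow_mul, mul_comm, pow_mul, hz, one_pow]
        · rw [mul_assoc a, Subgroup.mem_center_iff.mp (pow_mem hzc _) b, ← mul_assoc, ← hf a,
            inv_mul_cancel_right]
    have hker : p ^ 3 ≤ Nat.card π.ker := by
      have h1 : Nat.card (Additive G →+ ZMod p) * Nat.card (Subgroup.center G) ≤ Nat.card S := by
        rw [← Nat.card_prod]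
        have hZS : ∀ y ∈ Subgroup.center G, y ∈ S := fun y hy => ⟨0, fun x => by
          rw [← Subgroup.mem_center_iff.mp hy]; simp⟩
        refine Nat.card_le_card_of_injective
          (fun q => (⟨γ q.1 * q.2, mul_mem (hγS q.1) (hZS _ q.2.2)⟩ : S)) ?_
        rintro ⟨f, y⟩ ⟨f', y'⟩ h
        have h' : γ f * y = γ f' * y' := congrArg Subtype.val h
        obtain rfl := hγinj f f' y y' y.2 y'.2 h'
        rw [Subtype.ext (mul_left_cancel h')]
      have h2 : Nat.card S = Nat.card π.range * Nat.card π.ker := by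
        rw [← Subgroup.index_ker, Subgroup.index_mul_card]
      have h3 : Nat.card π.range ≤ Nat.card (Subgroup.center G) := Subgroup.card_le_card_group _
      have h4 : Nat.card (Subgroup.center G) * p ^ 3 ≤
          Nat.card (Subgroup.center G) * Nat.card π.ker := by
        calc _ ≤ Nat.card (Additive G →+ ZMod p) * Nat.card (Subgroup.center G) := by
              rw [mul_comm]; gcongr
          _ ≤ Nat.card π.range * Nat.card π.ker := h1.trans h2.le
          _ ≤ _ := by gcongr
      exact Nat.le_of_mul_le_mul_left h4 Nat.card_pos
    obtain ⟨f, hf⟩ : ∃ f : Additive G →+ ZMod p, f ≠ 0 := by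
      have : Nontrivial (Additive G →+ ZMod p) := Finite.one_lt_card_iff_nontrivial.mp
        ((Nat.one_lt_pow three_ne_zero hp.one_lt).trans_le hV)
      exact exists_ne 0
    have hs := hnc f hf
    -- Hence all central elements of order dividing `p` lie in a two-generator abelian group, where
    -- there are at most `p ^ 2` of them.
    have hle : L ≤ Subgroup.zpowers (γ f) ⊔ Subgroup.zpowers z :=
      (hcmpL _ (normal_zpowers_sup_of_mem_conjHomSubgroup (hγS f))).resolve_left fun h =>
        hs (hLc (h (Subgroup.mem_sup_left (Subgroup.mem_zpowers _))))
    have hT := hG.ncard_pow_eq_one_le_sq hp (s := γ f) (z := z)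
      (fun h => hs (h ▸ one_mem _)) (Subgroup.mem_center_iff.mp hzc _) hz
    have hcard : Nat.card π.ker ≤
        {x : G | x ^ p = 1 ∧ ∃ i j : ℤ, (γ f) ^ i * z ^ j = x}.ncard := by
      rw [← Nat.card_coe_set_eq]
      have hmem : ∀ y : π.ker, ((y : S) : G) ^ p = 1 := fun y => congrArg Subtype.val y.2
      refine Nat.card_le_card_of_injective (fun y => ⟨((y : S) : G), hmem y, ?_⟩) ?_
      · exact (mem_zpowers_sup_zpowers_iff hzc).mp
          (hle (hΩ _ (hcon _ (y : S).2 (hmem y)) (hmem y)))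
      · intro y y' h
        exact Subtype.ext (Subtype.ext (Subtype.mk.inj h))
    have := hker.trans (hcard.trans hT)
    exact absurd this (not_le.mpr (Nat.pow_lt_pow_right hp.one_lt (by norm_num)))
  obtain ⟨f, hwf⟩ := id hwS
  obtain ⟨g, hg⟩ := hinner _ (exists_mulAut_of_conj_eq hp hodd hzc hz hz1 hw hwf hwc)
  have hf : f ≠ 0 := by
    rintro rfl
    refine hwc (Subgroup.mem_center_iff.mpr fun x => ?_)
    have := hwf x
    simp only [AddMonoidHom.zero_apply, ZMod.val_zero, pow_zero, mul_one] at this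
    exact (mul_inv_eq_iff_eq_mul.mp this).symm
  obtain ⟨t, ht⟩ := AddMonoidHom.exists_eq_one_of_ne_zero hp hf
  have hKn := normal_zpowers_sup_of_mem_conjHomSubgroup hwS
  have hwK : w ∈ Subgroup.zpowers w ⊔ Subgroup.zpowers z :=
    Subgroup.mem_sup_left (Subgroup.mem_zpowers w)
  have hzK : z ∈ Subgroup.zpowers w ⊔ Subgroup.zpowers z :=
    Subgroup.mem_sup_right (Subgroup.mem_zpowers z)
  have hNn : (Subgroup.zpowers g ⊔ (Subgroup.zpowers w ⊔ Subgroup.zpowers z)).Normal := by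
    refine Subgroup.normal_zpowers_sup fun x => ?_
    have h := hg x⁻¹
    rw [← inv_mul_eq_iff_eq_mul, inv_inv, ← mul_assoc, ← mul_assoc, mul_inv_eq_iff_eq_mul] at h
    rw [h]
    exact mul_mem (Subgroup.mem_sup_right (mul_mem (pow_mem hwK _) (pow_mem hzK _)))
      (Subgroup.mem_sup_left (Subgroup.mem_zpowers g))
  rcases hcmpD _ hNn with hND | hDN
  -- At `t`, where `f t = 1`, the displacement under `g` is `w` times a power of `z`.
  · have h := hDL g (hND (Subgroup.mem_sup_left (Subgroup.mem_zpowers g))) t.toMul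
    rw [mul_assoc, mul_assoc, ← mul_assoc g, hg, inv_mul_cancel_left, ofMul_toMul, ht,
      ZMod.val_one, pow_one] at h
    exact hwc ((Subgroup.mul_mem_cancel_right _ (pow_mem hzc _)).mp h)
  · have hZD : Subgroup.center G ≤ D :=
      (hcmpD _ inferInstance).resolve_right hDc
    have hSD : S ≤ D := by
      intro s hs
      by_cases hsc : s ∈ Subgroup.center G
      · exact hZD hsc
      rcases hcmpD _ (normal_zpowers_sup_of_mem_conjHomSubgroup hs) with h | h
      · exact h (Subgroup.mem_sup_left (Subgroup.mem_zpowers s))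
      -- A noncentral `s ^ i * z ^ j` in `D` has `i` prime to `p`, as `s ^ p` is central; Bézout
      -- then recovers `s` from `s ^ i` and `s ^ p`.
      · obtain ⟨d, hdD, hdc⟩ := SetLike.not_le_iff_exists.mp hDc
        obtain ⟨i, j, rfl⟩ := (mem_zpowers_sup_zpowers_iff hzc).mp (h hdD)
        have hsp := pow_mem_center_of_mem_conjHomSubgroup hs
        have hi : IsCoprime i (p : ℤ) := by
          rw [isCoprime_comm, (Nat.prime_iff_prime_int.mp hp).coprime_iff_not_dvd]
          rintro ⟨k, rfl⟩
          refine hdc (mul_mem ?_ (zpow_mem hzc j))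
          rw [zpow_mul, zpow_natCast]
          exact zpow_mem hsp k
        have hsi : s ^ i ∈ D := (Subgroup.mul_mem_cancel_right _ (hZD (zpow_mem hzc j))).mp hdD
        obtain ⟨a, b, hab⟩ := hi
        rw [← zpow_one s, ← hab, zpow_add, mul_comm a, mul_comm b, zpow_mul, zpow_mul,
          zpow_natCast]
        exact mul_mem (zpow_mem hsi a) (zpow_mem (hZD hsp) b)
    have hvanish : ∀ (f' : Additive G →+ ZMod p) x, f x = 0 → f' x = 0 := by
      intro f' x hx
      have hle : Subgroup.zpowers g ⊔ (Subgroup.zpowers w ⊔ Subgroup.zpowers z) ≤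
          Subgroup.centralizer {x.toMul} := by
        simp only [sup_le_iff, Subgroup.zpowers_le, Subgroup.mem_centralizer_singleton_iff]
        refine ⟨?_, ?_, (Subgroup.mem_center_iff.mp hzc _).symm⟩
        · have := hg x.toMul
          simp only [ofMul_toMul, hx, ne_eq, OfNat.ofNat_ne_zero, not_false_eq_true, zero_pow,
            zero_mul, ZMod.val_zero, pow_zero, mul_one] at this
          exact mul_inv_eq_iff_eq_mul.mp this
        · have := hwf x.toMul
          simp only [ofMul_toMul, hx, ZMod.val_zero, pow_zero, mul_one] at this
          exact mul_inv_eq_iff_eq_mul.mp this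
      have h := hle (hDN (hSD (hγS f')))
      rw [Subgroup.mem_centralizer_singleton_iff] at h
      have h' := hγ f' x.toMul
      rw [h, mul_inv_cancel_right, left_eq_mul] at h'
      exact eq_zero_of_pow_val_eq_one hp hz hz1 h'
    -- Every homomorphism vanishes on `ker f`, so its value at `t` determines it: at most `p` exist.
    have hinj : Function.Injective (AddMonoidHom.eval (N := ZMod p) t) := by
      rw [injective_iff_map_eq_zero]
      intro f' hf'
      refine AddMonoidHom.ext fun x : Additive G => ?_
      have h := hvanish f' (x - (f x).val • t) (by
        rw [map_sub, map_nsmul, ht, nsmul_eq_mul, ZMod.natCast_zmod_val, mul_one, sub_self])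
      rw [map_sub, map_nsmul, show f' t = 0 from hf', smul_zero, sub_zero] at h
      exact h
    have hcard := Nat.card_le_card_of_injective _ hinj
    rw [Nat.card_zmod] at hcard
    have := hV.trans hcard
    nlinarith [hp.two_le, Nat.pow_lt_pow_right hp.one_lt (show 1 < 3 by norm_num)]

/-! ### Application to the lower central series -/

theorem theorem4p1 (p : ℕ) (hp : p.Prime) (hodd : Odd p)
    (G : Type*) [Group G] [Finite G] (hG : IsPGroup p G)
    (hNC : IsNormallyConstrained G) (hrank : 3 ≤ Group.rank G) :
    ∃ φ : MulAut G, orderOf φ = p ∧ φ ∉ (MulAut.conj : G →* MulAut G).range := by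
  have := Fact.mk hp
  have hV := hG.pow_three_le_card_addMonoidHom hp hrank
  have hGn : Group.IsNilpotent G := hG.isNilpotent
  have hex := Subgroup.nilpotent_iff_lowerCentralSeries.mp hGn
  classical
  have hmin := Nat.find_spec hex
  have hlt := fun m => Nat.find_min hex (m := m)
  generalize Nat.find hex = c at hmin hlt
  have hcomm : ∀ n, ∀ g ∈ (⊤ : Subgroup G).lowerCentralSeries n, ∀ x : G,
      x⁻¹ * g * x * g⁻¹ ∈ (⊤ : Subgroup G).lowerCentralSeries (n + 1) := by
    intro n g hg x
    have := Subgroup.commutator_mem_commutator hg (Subgroup.mem_top x⁻¹)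
    have h2 := inv_mem this
    rw [commutatorElement_inv, commutatorElement_def, inv_inv] at h2
    exact h2
  have hcenter : ∀ n, (⊤ : Subgroup G).lowerCentralSeries (n + 1) = ⊥ →
      (⊤ : Subgroup G).lowerCentralSeries n ≤ Subgroup.center G := by
    intro n hn g hg
    refine Subgroup.mem_center_iff.mpr fun x => ?_
    have := hcomm n g hg x
    rw [hn, Subgroup.mem_bot, mul_inv_eq_one, mul_assoc, inv_mul_eq_iff_eq_mul] at this
    exact this.symm
  have hcbot : ∀ n, (⊤ : Subgroup G).lowerCentralSeries n ≤ Subgroup.center G →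
      (⊤ : Subgroup G).lowerCentralSeries (n + 1) = ⊥ := by
    intro n hn
    rw [Subgroup.lowerCentralSeries_succ, Subgroup.commutator_eq_bot_iff_le_centralizer,
      Subgroup.coe_top, Subgroup.centralizer_univ]
    exact hn
  by_cases hab : ∀ g : G, g ∈ Subgroup.center G
  · have : Nontrivial G := by
      rw [← not_subsingleton_iff_nontrivial]
      intro hs
      have := Group.rank_eq_zero G
      omega
    obtain ⟨z, hz⟩ := exists_prime_orderOf_dvd_card' p
      (hG.card_eq_or_dvd.resolve_left Finite.one_lt_card.ne')
    have hK : Subgroup.zpowers z ≠ ⊤ := by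
      intro h
      have := Group.rank_le (S := {z}) (by
        rw [Finset.coe_singleton, ← h, Subgroup.zpowers_eq_closure])
      rw [Finset.card_singleton] at this
      omega
    obtain ⟨f, hf, hfz⟩ := hG.exists_addMonoidHom_eq_zero hp _ hK
    obtain ⟨φ, hφ, -⟩ := exists_mulAut_of_mem_center hp (hab z) (hz ▸ pow_orderOf_eq_one z)
      (fun h => hp.one_lt.ne (by rw [← hz, h, orderOf_one])) hf (hfz z (Subgroup.mem_zpowers z))
    refine ⟨φ, hφ, ?_⟩
    rintro ⟨g, rfl⟩
    have hg : MulAut.conj g = 1 := by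
      ext x
      rw [MulAut.conj_apply, ← Subgroup.mem_center_iff.mp (hab g), mul_inv_cancel_right,
        MulAut.one_apply]
    rw [hg, orderOf_one] at hφ
    exact hp.one_lt.ne hφ
  -- Here `c` is the nilpotency class. With indices starting at `0`, the last nontrivial term has
  -- index `c - 1 = n + 1`, and `D` has index `n`.
  · obtain ⟨n, rfl⟩ : ∃ n, c = n + 2 := by
      match c with
      | 0 =>
        refine absurd (fun g => ?_) hab
        have hg : g ∈ (⊤ : Subgroup G).lowerCentralSeries 0 := Subgroup.mem_top g
        rw [hmin, Subgroup.mem_bot] at hg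
        exact hg ▸ one_mem _
      | 1 => exact absurd (fun g => hcenter 0 hmin (Subgroup.mem_top g)) hab
      | n + 2 => exact ⟨n, rfl⟩
    refine exists_mulAut_not_mem_range_conj_of_comparable hp hodd hG hV
      (L := (⊤ : Subgroup G).lowerCentralSeries (n + 1))
      (D := (⊤ : Subgroup G).lowerCentralSeries n)
      (hlt (n + 1) (by omega)) (hcenter _ hmin) ?_ ?_ ?_ (hNC _) (hNC _)
    · rw [← Subgroup.top_lowerCentralSeries_one]
      exact Subgroup.lowerCentralSeries_antitone _ (by omega)
    · exact fun g hg x => hcenter _ hmin (hcomm n g hg x)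
    · exact fun h => hlt (n + 1) (by omega) (hcbot n h)
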